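/- For each $n$ let $p=p(n)\in[0,1]$ and $q=q(n)=1-p(n)$, let $G(n,p)$ be the random graph on $n$ labelled vertices in which each of the $\binom n2$ edges is present independently with probability $p$, and let $\nu_n$ be the number of connected components of $G(n,p)$. Suppose that $nq^n\to\alpha$ as $n\to\infty$, where $\alpha>0$ is a fixed constant. Then: 1. for every fixed integer $k\ge 1$, $$\mathsf P\{\nu_n=k\}\to\frac{\alpha^{k-1}}{(k-1)!}e^{-\alpha}\qquad(n\to\infty);$$ 2. $\nu_n-1$ converges in distribution to the Poisson distribution with parameter $\alpha$; 3. for every fixed integer $s\ge 0$, the $s$-th factorial moment of $\nu_n-1$ satisfies $$\mathsf E\big[(\nu_n-1)(\nu_n-2)\cdots(\nu_n-s)\big]\to\alpha^s\qquad(n\to\infty),$$ where the empty product for $s=0$ is $1$. -/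

import Mathlib

open MeasureTheory ProbabilityTheory Filter Topology

/-- The number of connected components of a graph. (It is `0` for the graph without vertices.) -/
noncomputable def numComponents {V : Type*} (G : SimpleGraph V) : ℕ :=
  Nat.card G.ConnectedComponent

/-- The `s`-th factorial power `z (z - 1) ⋯ (z - s + 1)` of a real number `z`. -/
noncomputable def factorialPower (z : ℝ) (s : ℕ) : ℝ :=
  ∏ i ∈ Finset.range s, (z - i)

/-! With high probability `G(n, p)` consists of isolated vertices and one further component, so `ν -
1` is the number of isolated vertices. The `s`-th binomial moment of that number lies between `C(n,
s) q ^ (s n)` and `C(n, s) q ^ (s (n - s))`, and both tend to `α ^ s / s!`.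

Both error estimates rest on `halfCutSum`, which stays bounded (`exists_halfCutSum_le`). If the
structure fails, the graph is empty or an edge lies in a set of at most half of the vertices that no
edge leaves. A union bound gives the latter probability at most `p * halfCutSum`, and `p → 0`. To
carry moments across the exceptional event, unions of components are sets that no edge leaves, so `E
2 ^ ν ≤ 2 * halfCutSum`; this exponential moment dominates every power of `ν`.

Bonferroni's inequalities turn the limits of the binomial moments into limits of the point
probabilities, and these give convergence in distribution by the open-set criterion. -/

/-! ### The law of the random graph. -/

instance SimpleGraph.instMeasurableSingletonClass {V : Type*} [Countable V] :
    MeasurableSingletonClass (SimpleGraph V) where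
  measurableSet_singleton G := by
    have h : ({G} : Set (SimpleGraph V)) = SimpleGraph.edgeSet ⁻¹' {G.edgeSet} := by
      ext H; simp
    rw [h]
    exact SimpleGraph.measurable_edgeSet (measurableSet_singleton _)

/-- A prescribed set of edges is absent from `G(V, p)` with probability `(1 - p)` to the number of
these edges. -/
lemma binomialRandom_real_forall_notMem_edgeSet {V : Type*} [Countable V] (p : unitInterval)
    (F : Finset (Sym2 V)) (hF : ∀ e ∈ F, ¬ e.IsDiag) :
    (SimpleGraph.binomialRandom V p).real {G | ∀ e ∈ F, e ∉ G.edgeSet} =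
      (1 - (p : ℝ)) ^ F.card := by
  -- Every set of off-diagonal pairs is an edge set, so passing from graphs to sets of pairs only
  -- adds the constraint of avoiding the diagonal, which does not change the Bernoulli measure.
  have h1 : SimpleGraph.edgeSet '' {G : SimpleGraph V | ∀ e ∈ F, e ∉ G.edgeSet} =
      {s ∈ {s : Set (Sym2 V) | ∀ e ∈ F, e ∉ s} | s ⊆ Sym2.diagSetᶜ} := by
    ext s
    constructor
    · rintro ⟨G, hG, rfl⟩
      exact ⟨hG, G.edgeSet_subset_compl_diagSet⟩
    · rintro ⟨hs, hd⟩
      have : (SimpleGraph.fromEdgeSet s).edgeSet = s := by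
        rw [SimpleGraph.edgeSet_fromEdgeSet]
        ext e
        simp only [Set.mem_sdiff, and_iff_left_iff_imp]
        exact fun he => hd he
      exact ⟨SimpleGraph.fromEdgeSet s, by simpa only [Set.mem_ofPred_eq, this] using hs, this⟩
  rw [measureReal_def, SimpleGraph.binomialRandom_apply', h1,
    ← setBernoulli_apply_eq_apply_subsets, setBernoulli_apply']
  have h2 : ((fun p : Sym2 V → Prop ↦ {i | p i}) ⁻¹' {s : Set (Sym2 V) | ∀ e ∈ F, e ∉ s}) =
      Set.pi F (fun _ => {False}) := by
    ext f; simp [Set.mem_pi]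
  rw [h2, Measure.infinitePi_pi _ (by simp), Finset.prod_congr rfl (g := fun _ =>
    ((unitInterval.toNNReal (unitInterval.symm p) : NNReal) : ENNReal))]
  · simp
  · intro e he
    simp [hF e he]

/-! ### Isolated vertices, closed sets and components. -/

open Classical in
/-- The vertices without neighbours. -/
noncomputable def isolatedVerts {V : Type*} [Fintype V] (G : SimpleGraph V) : Finset V :=
  Finset.univ.filter fun v => ∀ w, ¬ G.Adj v w

/-- No edge leaves `S`. -/
def IsClosedUnder {V : Type*} (G : SimpleGraph V) (S : Finset V) : Prop :=
  ∀ u ∈ S, ∀ v ∉ S, ¬ G.Adj u v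

/-- Some set of at most half of the vertices contains an edge, and no edge leaves it. -/
def HasSmallClosedEdge {V : Type*} [Fintype V] (G : SimpleGraph V) : Prop :=
  ∃ S : Finset V, 2 * S.card ≤ Fintype.card V ∧ IsClosedUnder G S ∧ ∃ u ∈ S, ∃ v ∈ S, G.Adj u v

lemma mem_isolatedVerts {V : Type*} [Fintype V] {G : SimpleGraph V} {v : V} :
    v ∈ isolatedVerts G ↔ ∀ w, ¬ G.Adj v w := by
  simp [isolatedVerts]

lemma eq_of_reachable_of_mem_isolatedVerts {V : Type*} [Fintype V] {G : SimpleGraph V} {v w : V}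
    (hv : v ∈ isolatedVerts G) (h : G.Reachable v w) : v = w := by
  obtain ⟨p⟩ := h
  cases p with
  | nil => rfl
  | cons h _ => exact absurd h (mem_isolatedVerts.1 hv _)

lemma card_isolatedVerts_le_numComponents {V : Type*} [Fintype V] (G : SimpleGraph V) :
    (isolatedVerts G).card ≤ numComponents G := by
  classical
  have h := Nat.card_le_card_of_injective
    (fun v : isolatedVerts G => G.connectedComponentMk v) (fun v w hvw =>
      Subtype.ext (eq_of_reachable_of_mem_isolatedVerts v.2
        (SimpleGraph.ConnectedComponent.exact hvw)))
  simpa [numComponents] using h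

/-- A component with an edge is closed, hence has more than half of the vertices; two such
components would overlap. As `G ≠ ⊥`, exactly one exists. -/
lemma numComponents_eq_card_isolatedVerts_add_one {V : Type*} [Fintype V] {G : SimpleGraph V}
    (hG : G ≠ ⊥) (h : ¬ HasSmallClosedEdge G) :
    numComponents G = (isolatedVerts G).card + 1 := by
  classical
  obtain ⟨a, b, hab⟩ := SimpleGraph.ne_bot_iff_exists_adj.1 hG
  let S : V → Finset V := fun v => Finset.univ.filter fun w => G.Reachable v w
  have hclosed : ∀ v, IsClosedUnder G (S v) := by
    intro v x hx y hy hxy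
    simp only [S, Finset.mem_filter, Finset.mem_univ, true_and] at hx hy
    exact hy (hx.trans hxy.reachable)
  have hbig : ∀ v w, G.Adj v w → Fintype.card V < 2 * (S v).card := by
    intro v w hvw
    by_contra! hle
    exact h ⟨S v, hle, hclosed v, v, by simp [S], w, by simp [S, hvw.reachable], hvw⟩
  have hreach : ∀ v w, G.Adj v w → G.Reachable a v := by
    intro v w hvw
    by_contra hn
    have hd : Disjoint (S a) (S v) := by
      rw [Finset.disjoint_left]
      intro x hx hx'
      simp only [S, Finset.mem_filter, Finset.mem_univ, true_and] at hx hx'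
      exact hn (hx.trans hx'.symm)
    have h1 := Finset.card_union_of_disjoint hd
    have h2 := Finset.card_le_univ (S a ∪ S v)
    have h3 := hbig v w hvw
    have h4 := hbig a b hab
    omega
  let f : Option (isolatedVerts G) → G.ConnectedComponent := fun o =>
    o.elim (G.connectedComponentMk a) fun v => G.connectedComponentMk v
  have hf : Function.Bijective f := by
    constructor
    · rintro (_ | ⟨v, hv⟩) (_ | ⟨w, hw⟩) hvw
      · rfl
      · have := eq_of_reachable_of_mem_isolatedVerts hw
          (SimpleGraph.ConnectedComponent.exact hvw.symm)
        subst this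
        exact absurd hab (mem_isolatedVerts.1 hw _)
      · have := eq_of_reachable_of_mem_isolatedVerts hv (SimpleGraph.ConnectedComponent.exact hvw)
        subst this
        exact absurd hab (mem_isolatedVerts.1 hv _)
      · have := eq_of_reachable_of_mem_isolatedVerts hv (SimpleGraph.ConnectedComponent.exact hvw)
        subst this
        rfl
    · intro c
      induction c using SimpleGraph.ConnectedComponent.ind with
      | h v =>
        by_cases hv : v ∈ isolatedVerts G
        · exact ⟨some ⟨v, hv⟩, rfl⟩
        · rw [mem_isolatedVerts] at hv
          push Not at hv
          obtain ⟨w, hw⟩ := hv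
          exact ⟨none, SimpleGraph.ConnectedComponent.sound (hreach v w hw)⟩
  rw [numComponents, ← Nat.card_eq_of_bijective f hf, Finite.card_option]
  simp

open Classical in
/-- There are at least `2 ^ numComponents G` sets of vertices that no edge leaves. -/
lemma two_pow_numComponents_le {V : Type*} [Fintype V] (G : SimpleGraph V) :
    2 ^ numComponents G ≤ (Finset.univ.filter fun S : Finset V => IsClosedUnder G S).card := by
  -- A set of components is sent to its union, from which it can be recovered because components are
  -- nonempty.
  let f : Set G.ConnectedComponent → {S : Finset V // IsClosedUnder G S} := fun T =>
    ⟨Finset.univ.filter fun v => G.connectedComponentMk v ∈ T, by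
      intro u hu v hv huv
      simp only [Finset.mem_filter, Finset.mem_univ, true_and] at hu hv
      rw [SimpleGraph.ConnectedComponent.connectedComponentMk_eq_of_adj huv] at hu
      exact hv hu⟩
  have hf : Function.Injective f := by
    intro T T' h
    ext c
    induction c using SimpleGraph.ConnectedComponent.ind with
    | h v =>
      have := congrArg (fun S => v ∈ S.1) h
      simpa [f] using this
  have h := Nat.card_le_card_of_injective f hf
  rw [Nat.card_eq_fintype_card (α := {S : Finset V // IsClosedUnder G S}),
    Fintype.card_subtype] at h
  rw [numComponents]
  refine le_trans (le_of_eq ?_) h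
  let _ : Fintype G.ConnectedComponent := Fintype.ofFinite _
  rw [Nat.card_eq_fintype_card, Nat.card_eq_fintype_card, Fintype.card_set]

/-! ### Pairs that must be absent for closed sets and for isolated vertices. -/

section EdgeSets

variable {V : Type*} [Fintype V] [DecidableEq V]

/-- The pairs of vertices with one end in `S` and the other outside `S`. -/
def cutEdges (S : Finset V) : Finset (Sym2 V) :=
  (S ×ˢ Sᶜ).image fun x => s(x.1, x.2)

/-- The pairs of distinct vertices with at least one end in `S`. -/
def starEdges (S : Finset V) : Finset (Sym2 V) :=
  ((S ×ˢ Finset.univ).filter fun x => x.1 ≠ x.2).image fun x => s(x.1, x.2)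

lemma mk_mem_cutEdges {S : Finset V} {u v : V} :
    s(u, v) ∈ cutEdges S ↔ (u ∈ S ∧ v ∉ S) ∨ (v ∈ S ∧ u ∉ S) := by
  simp only [cutEdges, Finset.mem_image, Finset.mem_product, Finset.mem_compl, Prod.exists,
    Sym2.eq_iff]
  grind

lemma mk_mem_starEdges {S : Finset V} {u v : V} :
    s(u, v) ∈ starEdges S ↔ u ≠ v ∧ (u ∈ S ∨ v ∈ S) := by
  simp only [starEdges, Finset.mem_image, Finset.mem_filter, Finset.mem_product, Finset.mem_univ,
    Prod.exists, Sym2.eq_iff, and_true]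
  constructor
  · rintro ⟨a, b, ⟨ha, hab⟩, ⟨rfl, rfl⟩ | ⟨rfl, rfl⟩⟩
    · exact ⟨hab, Or.inl ha⟩
    · exact ⟨hab.symm, Or.inr ha⟩
  · rintro ⟨huv, hu | hv⟩
    · exact ⟨u, v, ⟨hu, huv⟩, Or.inl ⟨rfl, rfl⟩⟩
    · exact ⟨v, u, ⟨hv, huv.symm⟩, Or.inr ⟨rfl, rfl⟩⟩

lemma not_isDiag_of_mem_cutEdges {S : Finset V} {e : Sym2 V} (he : e ∈ cutEdges S) :
    ¬ e.IsDiag := by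
  induction e with
  | h u v =>
    rw [mk_mem_cutEdges] at he
    rw [Sym2.mk_isDiag_iff]
    rintro rfl
    tauto

lemma not_isDiag_of_mem_starEdges {S : Finset V} {e : Sym2 V} (he : e ∈ starEdges S) :
    ¬ e.IsDiag := by
  induction e with
  | h u v => exact (mk_mem_starEdges.1 he).1

lemma card_cutEdges (S : Finset V) :
    (cutEdges S).card = S.card * (Fintype.card V - S.card) := by
  rw [cutEdges, Finset.card_image_of_injOn, Finset.card_product, Finset.card_compl]
  rintro ⟨a, b⟩ h ⟨c, d⟩ h' hab
  simp only [Finset.coe_product, Set.mem_prod, Finset.mem_coe, Finset.mem_compl] at h h'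
  simp only [Sym2.eq_iff] at hab
  grind

lemma card_starEdges_le (S : Finset V) :
    (starEdges S).card ≤ S.card * Fintype.card V := by
  refine Finset.card_image_le.trans ((Finset.card_filter_le _ _).trans ?_)
  rw [Finset.card_product, Finset.card_univ]

lemma card_cutEdges_le_card_starEdges (S : Finset V) :
    (cutEdges S).card ≤ (starEdges S).card := by
  refine Finset.card_le_card fun e he => ?_
  induction e with
  | h u v =>
    rw [mk_mem_cutEdges] at he
    rw [mk_mem_starEdges]
    grind

lemma forall_mem_cutEdges_iff {G : SimpleGraph V} {S : Finset V} :
    (∀ e ∈ cutEdges S, e ∉ G.edgeSet) ↔ IsClosedUnder G S := by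
  constructor
  · intro h u hu v hv huv
    exact h s(u, v) (mk_mem_cutEdges.2 (Or.inl ⟨hu, hv⟩)) huv
  · intro h e
    induction e with
    | h u v =>
      rw [mk_mem_cutEdges]
      rintro (⟨hu, hv⟩ | ⟨hv, hu⟩) huv
      · exact h u hu v hv huv
      · exact h v hv u hu (SimpleGraph.Adj.symm huv)

lemma forall_mem_starEdges_iff {G : SimpleGraph V} {S : Finset V} :
    (∀ e ∈ starEdges S, e ∉ G.edgeSet) ↔ S ⊆ isolatedVerts G := by
  constructor
  · intro h u hu
    rw [mem_isolatedVerts]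
    intro v huv
    exact h s(u, v) (mk_mem_starEdges.2 ⟨huv.ne, Or.inl hu⟩) huv
  · intro h e
    induction e with
    | h u v =>
      rw [mk_mem_starEdges]
      rintro ⟨-, hu | hv⟩ huv
      · exact mem_isolatedVerts.1 (h hu) v huv
      · exact mem_isolatedVerts.1 (h hv) u (SimpleGraph.Adj.symm huv)

end EdgeSets

/-! ### Probability and moment bounds for fixed `n`. -/

section Probabilities

variable {V : Type*} [Fintype V] (p : unitInterval)

lemma binomialRandom_real_isClosedUnder (S : Finset V) :
    (SimpleGraph.binomialRandom V p).real {G | IsClosedUnder G S} =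
      (1 - (p : ℝ)) ^ (S.card * (Fintype.card V - S.card)) := by
  classical
  simp_rw [← forall_mem_cutEdges_iff, ← card_cutEdges]
  exact binomialRandom_real_forall_notMem_edgeSet p _ fun e => not_isDiag_of_mem_cutEdges

/-- The pair `s(u, v)` is not in the cut, so for `u ≠ v` the probability is `q ^ m - q ^ (m + 1) = p
* q ^ m`, with `m` the size of the cut. The factor `p` is what later makes small closed sets with an
edge unlikely. -/
lemma binomialRandom_real_isClosedUnder_adj {S : Finset V} {u v : V} (hu : u ∈ S) (hv : v ∈ S) :
    (SimpleGraph.binomialRandom V p).real {G | IsClosedUnder G S ∧ G.Adj u v} ≤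
      p * (1 - (p : ℝ)) ^ (S.card * (Fintype.card V - S.card)) := by
  classical
  by_cases huv : u = v
  · subst huv
    simp only [SimpleGraph.irrefl, and_false, Set.ofPred_false, measureReal_empty]
    exact mul_nonneg p.2.1 (pow_nonneg (sub_nonneg.2 p.2.2) _)
  have hn : s(u, v) ∉ cutEdges S := by
    rw [mk_mem_cutEdges]; tauto
  have h1 := binomialRandom_real_forall_notMem_edgeSet p (insert s(u, v) (cutEdges S)) (by
    intro e he
    rcases Finset.mem_insert.1 he with rfl | he
    · simpa using huv
    · exact not_isDiag_of_mem_cutEdges he)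
  simp only [Finset.forall_mem_insert, forall_mem_cutEdges_iff, Finset.card_insert_of_notMem hn,
    card_cutEdges, SimpleGraph.mem_edgeSet] at h1
  have h2 := binomialRandom_real_isClosedUnder p S
  have h3 : {G : SimpleGraph V | IsClosedUnder G S ∧ G.Adj u v} =
      {G | IsClosedUnder G S} \ {G | ¬ G.Adj u v ∧ IsClosedUnder G S} := by
    ext G
    simp only [Set.mem_ofPred_eq, Set.mem_sdiff]
    tauto
  rw [h3, measureReal_sdiff (fun G hG => hG.2) (MeasurableSet.of_discrete), h1, h2, pow_succ]
  exact le_of_eq (by ring)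

lemma le_binomialRandom_real_subset_isolatedVerts (S : Finset V) :
    (1 - (p : ℝ)) ^ (S.card * Fintype.card V) ≤
      (SimpleGraph.binomialRandom V p).real {G | S ⊆ isolatedVerts G} := by
  classical
  simp_rw [← forall_mem_starEdges_iff]
  rw [binomialRandom_real_forall_notMem_edgeSet p _ fun e => not_isDiag_of_mem_starEdges]
  exact pow_le_pow_of_le_one (sub_nonneg.2 p.2.2) (sub_le_self _ p.2.1) (card_starEdges_le S)

lemma binomialRandom_real_subset_isolatedVerts_le (S : Finset V) :
    (SimpleGraph.binomialRandom V p).real {G | S ⊆ isolatedVerts G} ≤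
      (1 - (p : ℝ)) ^ (S.card * (Fintype.card V - S.card)) := by
  classical
  simp_rw [← forall_mem_starEdges_iff]
  rw [binomialRandom_real_forall_notMem_edgeSet p _ fun e => not_isDiag_of_mem_starEdges,
    ← card_cutEdges]
  exact pow_le_pow_of_le_one (sub_nonneg.2 p.2.2) (sub_le_self _ p.2.1)
    (card_cutEdges_le_card_starEdges S)

/-- In the empty graph any given vertex is isolated. -/
lemma binomialRandom_real_eq_bot_le [Nonempty V] :
    (SimpleGraph.binomialRandom V p).real {G | G = ⊥} ≤
      (1 - (p : ℝ)) ^ (Fintype.card V - 1) := by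
  obtain ⟨v⟩ := ‹Nonempty V›
  have h := binomialRandom_real_isClosedUnder p {v}
  simp only [Finset.card_singleton, one_mul] at h
  rw [← h]
  refine measureReal_mono ?_
  rintro G rfl
  exact fun _ _ _ _ h => h

open Classical in
lemma integral_card_filter {Ω ι : Type*} [MeasurableSpace Ω] [Finite Ω]
    [MeasurableSingletonClass Ω] (μ : Measure Ω) [IsFiniteMeasure μ] (s : Finset ι)
    (P : ι → Ω → Prop) :
    ∫ ω, ((s.filter fun i => P i ω).card : ℝ) ∂μ = ∑ i ∈ s, μ.real {ω | P i ω} := by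
  have h : ∀ ω, ((s.filter fun i => P i ω).card : ℝ) =
      ∑ i ∈ s, Set.indicator {ω | P i ω} (1 : Ω → ℝ) ω := by
    intro ω
    rw [Finset.card_filter, Nat.cast_sum]
    refine Finset.sum_congr rfl fun i _ => ?_
    by_cases hi : P i ω <;> simp [hi]
  simp_rw [h]
  rw [integral_finsetSum _ fun i _ => Integrable.of_finite]
  exact Finset.sum_congr rfl fun i _ => integral_indicator_one MeasurableSet.of_discrete

/-- The sum over `k ≤ n / 2` of `(k + 1)² (n choose k) q ^ (k (n - k))`. -/
noncomputable def halfCutSum (n : ℕ) (q : ℝ) : ℝ :=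
  ∑ k ∈ Finset.range (n / 2 + 1), ((k : ℝ) + 1) ^ 2 * ((n.choose k : ℝ) * q ^ (k * (n - k)))

lemma sum_card_le_half (g : ℕ → ℝ) :
    ∑ S : Finset V, (if 2 * S.card ≤ Fintype.card V then g S.card else 0) =
      ∑ k ∈ Finset.range (Fintype.card V / 2 + 1), ((Fintype.card V).choose k : ℝ) * g k := by
  have h := Finset.sum_powerset_apply_card
    (fun k => if 2 * k ≤ Fintype.card V then g k else 0) (x := (Finset.univ : Finset V))
  rw [Finset.powerset_univ, Finset.card_univ] at h
  rw [h]
  simp only [nsmul_eq_mul, mul_ite, mul_zero]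
  rw [← Finset.sum_filter]
  refine Finset.sum_congr ?_ fun _ _ => rfl
  ext k
  simp only [Finset.mem_filter, Finset.mem_range]
  omega

/-- Bounds the expected number of closed sets; this is the exponential moment that controls `ν` on
the exceptional event. -/
lemma integral_two_pow_numComponents_le :
    ∫ G, (2 : ℝ) ^ numComponents G ∂(SimpleGraph.binomialRandom V p) ≤
      2 * halfCutSum (Fintype.card V) (1 - p) := by
  classical
  have hq : (0 : ℝ) ≤ 1 - p := sub_nonneg.2 p.2.2
  set q : ℝ := 1 - p with hqdef
  set n := Fintype.card V
  calc ∫ G, (2 : ℝ) ^ numComponents G ∂(SimpleGraph.binomialRandom V p)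
      ≤ ∫ G, ((Finset.univ.filter fun S : Finset V => IsClosedUnder G S).card : ℝ)
          ∂(SimpleGraph.binomialRandom V p) := by
        refine integral_mono Integrable.of_finite Integrable.of_finite fun G => ?_
        have := two_pow_numComponents_le G
        simp only
        exact_mod_cast (by convert this)
    _ = ∑ S : Finset V, q ^ (S.card * (n - S.card)) := by
        have := integral_card_filter (SimpleGraph.binomialRandom V p) Finset.univ
          (fun (S : Finset V) (G : SimpleGraph V) => IsClosedUnder G S)
        simp_rw [binomialRandom_real_isClosedUnder] at this
        exact this
    -- The cut is symmetric, and `S` or its complement has at most half of the vertices. Sets of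
    -- exactly half are counted twice, which is harmless.
    _ ≤ ∑ S : Finset V, ((if 2 * S.card ≤ n then q ^ (S.card * (n - S.card)) else 0) +
          (if 2 * Sᶜ.card ≤ n then q ^ (Sᶜ.card * (n - Sᶜ.card)) else 0)) := by
        refine Finset.sum_le_sum fun S _ => ?_
        have hc : Sᶜ.card = n - S.card := Finset.card_compl S
        have hS : S.card ≤ n := Finset.card_le_univ S
        have h0 : ∀ m : ℕ, 0 ≤ q ^ m := fun m => pow_nonneg hq m
        by_cases h : 2 * S.card ≤ n
        · rw [if_pos h]
          refine le_add_of_nonneg_right ?_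
          split_ifs
          · exact h0 _
          · exact le_rfl
        · rw [if_neg h, if_pos (by omega), hc, Nat.sub_sub_self hS, mul_comm, zero_add]
    _ = 2 * ∑ S : Finset V, (if 2 * S.card ≤ n then q ^ (S.card * (n - S.card)) else 0) := by
        rw [Finset.sum_add_distrib, two_mul]
        congr 1
        exact Equiv.sum_comp (Equiv.ofBijective _ compl_bijective)
          (fun S : Finset V => if 2 * S.card ≤ n then q ^ (S.card * (n - S.card)) else 0)
    _ ≤ 2 * halfCutSum n q := by
        rw [sum_card_le_half (fun k => q ^ (k * (n - k)))]
        refine mul_le_mul_of_nonneg_left ?_ zero_le_two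
        refine Finset.sum_le_sum fun k _ => le_mul_of_one_le_left (by positivity) ?_
        exact one_le_pow₀ (by linarith [k.cast_nonneg (α := ℝ)])

/-- Union bound over `S` and over the `|S| ^ 2` ordered pairs in `S`; hence the weight `(k + 1) ^ 2`
in `halfCutSum`. -/
lemma binomialRandom_real_hasSmallClosedEdge_le :
    (SimpleGraph.binomialRandom V p).real {G | HasSmallClosedEdge G} ≤
      p * halfCutSum (Fintype.card V) (1 - p) := by
  classical
  have hq : (0 : ℝ) ≤ 1 - p := sub_nonneg.2 p.2.2
  set q : ℝ := 1 - p with hqdef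
  set n := Fintype.card V with hn
  set μ := SimpleGraph.binomialRandom V p
  calc μ.real {G | HasSmallClosedEdge G}
      ≤ μ.real (⋃ S ∈ Finset.univ.filter (fun S : Finset V => 2 * S.card ≤ n),
          ⋃ x ∈ S ×ˢ S, {G | IsClosedUnder G S ∧ G.Adj x.1 x.2}) := by
        refine measureReal_mono ?_ (measure_ne_top _ _)
        rintro G ⟨S, hS, hc, u, hu, v, hv, huv⟩
        simp only [Set.mem_iUnion]
        exact ⟨S, by simpa using hS, (u, v), by simp [hu, hv], hc, huv⟩
    _ ≤ ∑ S ∈ Finset.univ.filter (fun S : Finset V => 2 * S.card ≤ n),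
          ∑ x ∈ S ×ˢ S, μ.real {G | IsClosedUnder G S ∧ G.Adj x.1 x.2} :=
        (measureReal_biUnion_finset_le _ _).trans
          (Finset.sum_le_sum fun S _ => measureReal_biUnion_finset_le _ _)
    _ ≤ ∑ S ∈ Finset.univ.filter (fun S : Finset V => 2 * S.card ≤ n),
          (p : ℝ) * (((S.card : ℝ) + 1) ^ 2 * q ^ (S.card * (n - S.card))) := by
        refine Finset.sum_le_sum fun S _ => ?_
        have h : ∀ x ∈ S ×ˢ S, μ.real {G | IsClosedUnder G S ∧ G.Adj x.1 x.2} ≤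
            p * q ^ (S.card * (n - S.card)) := fun x hx =>
          binomialRandom_real_isClosedUnder_adj p (Finset.mem_product.1 hx).1
            (Finset.mem_product.1 hx).2
        refine (Finset.sum_le_card_nsmul _ _ _ h).trans ?_
        rw [Finset.card_product, nsmul_eq_mul, Nat.cast_mul]
        have h0 : 0 ≤ (p : ℝ) * q ^ (S.card * (n - S.card)) :=
          mul_nonneg p.2.1 (pow_nonneg hq _)
        nlinarith [S.card.cast_nonneg (α := ℝ)]
    _ = p * halfCutSum n q := by
        rw [← Finset.mul_sum, Finset.sum_filter,
          sum_card_le_half (fun k => ((k : ℝ) + 1) ^ 2 * q ^ (k * (n - k))), halfCutSum]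
        congr 1
        exact Finset.sum_congr rfl fun k _ => by ring

lemma integral_choose_card_isolatedVerts (s : ℕ) :
    ∫ G, ((isolatedVerts G).card.choose s : ℝ) ∂(SimpleGraph.binomialRandom V p) =
      ∑ S ∈ Finset.univ.powersetCard s,
        (SimpleGraph.binomialRandom V p).real {G | S ⊆ isolatedVerts G} := by
  classical
  rw [← integral_card_filter]
  congr 1
  ext G
  rw [← Finset.card_powersetCard]
  congr 2
  ext S
  simp only [Finset.mem_powersetCard, Finset.mem_filter, Finset.subset_univ, true_and]
  tauto

lemma le_integral_choose_card_isolatedVerts (s : ℕ) :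
    ((Fintype.card V).choose s : ℝ) * (1 - (p : ℝ)) ^ (s * Fintype.card V) ≤
      ∫ G, ((isolatedVerts G).card.choose s : ℝ) ∂(SimpleGraph.binomialRandom V p) := by
  rw [integral_choose_card_isolatedVerts, ← nsmul_eq_mul, ← Finset.card_univ,
    ← Finset.card_powersetCard]
  refine Finset.card_nsmul_le_sum _ _ _ fun S hS => ?_
  rw [← (Finset.mem_powersetCard.1 hS).2]
  exact le_binomialRandom_real_subset_isolatedVerts p S

lemma integral_choose_card_isolatedVerts_le (s : ℕ) :
    ∫ G, ((isolatedVerts G).card.choose s : ℝ) ∂(SimpleGraph.binomialRandom V p) ≤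
      ((Fintype.card V).choose s : ℝ) * (1 - (p : ℝ)) ^ (s * (Fintype.card V - s)) := by
  rw [integral_choose_card_isolatedVerts, ← nsmul_eq_mul, ← Finset.card_univ,
    ← Finset.card_powersetCard]
  refine Finset.sum_le_card_nsmul _ _ _ fun S hS => ?_
  rw [← (Finset.mem_powersetCard.1 hS).2]
  exact binomialRandom_real_subset_isolatedVerts_le p S

end Probabilities

/-! ### Uniform bound for `halfCutSum`. -/

/-- Controls the loss `q ^ (-k ^ 2)` from replacing `k n` by `k (n - k)`. Split `log n = log (n / k)
+ log k`, with `log (n / k) ≤ n / k` and `k / n ≤ 1 / 2`. The coefficient `1 / 2` of `log k` lets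
`k!` absorb the loss with half of its logarithm to spare. -/
lemma log_nat_mul_div_le {k n : ℕ} (hk : 0 < k) (hkn : 2 * k ≤ n) :
    (k : ℝ) / n * Real.log n ≤ 1 + Real.log k / 2 := by
  have hk' : (1 : ℝ) ≤ k := by exact_mod_cast hk
  have hn' : (0 : ℝ) < n := by exact_mod_cast (by omega : 0 < n)
  have hkn' : 2 * (k : ℝ) ≤ n := by exact_mod_cast hkn
  have h1 : Real.log n = Real.log (n / k) + Real.log k := by
    rw [Real.log_div (by positivity) (by positivity)]; ring
  have h2 : Real.log (n / k) ≤ n / k := Real.log_le_self (by positivity)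
  have h3 : (k : ℝ) / n * Real.log (n / k) ≤ 1 := by
    calc (k : ℝ) / n * Real.log (n / k) ≤ k / n * (n / k) := by gcongr
      _ = 1 := by field_simp
  have h4 : (k : ℝ) / n ≤ 1 / 2 := by
    rw [div_le_div_iff₀ hn' two_pos]; linarith
  have h5 : 0 ≤ Real.log k := Real.log_nonneg hk'
  rw [h1, mul_add]
  nlinarith

lemma nat_mul_log_le (k : ℕ) : k * Real.log k ≤ k + Real.log k.factorial := by
  rcases Nat.eq_zero_or_pos k with rfl | hk
  · simp
  have hk' : (0 : ℝ) < k := by exact_mod_cast hk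
  have hf : (0 : ℝ) < k.factorial := by exact_mod_cast k.factorial_pos
  have h := Real.pow_div_factorial_le_exp (k : ℝ) hk'.le k
  have h2 := Real.log_le_log (by positivity) h
  rw [Real.log_div (by positivity) hf.ne', Real.log_pow, Real.log_exp] at h2
  linarith

/-- If `a₀ ≤ n qⁿ ≤ A` then `(n choose k) q ^ (k (n - k))` decays superexponentially in `k ≤ n / 2`,
uniformly in `n`. -/
lemma choose_mul_pow_le {k n : ℕ} {q a₀ A : ℝ} (hkn : 2 * k ≤ n) (hn : 0 < n) (hq : 0 < q)
    (ha₀ : 0 < a₀) (ha₁ : a₀ ≤ 1) (hl : a₀ ≤ n * q ^ n) (hu : n * q ^ n ≤ A) :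
    (n.choose k : ℝ) * q ^ (k * (n - k)) ≤
      Real.exp (k * (Real.log A + 3 / 2 - Real.log a₀ / 2) - Real.log k.factorial / 2) := by
  rcases Nat.eq_zero_or_pos k with rfl | hk
  · simp
  have hk' : (0 : ℝ) < k := by exact_mod_cast hk
  have hn' : (0 : ℝ) < n := by exact_mod_cast hn
  have hf : (0 : ℝ) < k.factorial := by exact_mod_cast k.factorial_pos
  have hkn' : 2 * (k : ℝ) ≤ n := by exact_mod_cast hkn
  have ha : 0 < n * q ^ n := ha₀.trans_le hl
  have hlog : Real.log (n * q ^ n) = Real.log n + n * Real.log q := by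
    rw [Real.log_mul hn'.ne' (by positivity), Real.log_pow]
  have hL : Real.log a₀ ≤ Real.log n + n * Real.log q := hlog ▸ Real.log_le_log ha₀ hl
  have hU : Real.log n + n * Real.log q ≤ Real.log A := hlog ▸ Real.log_le_log ha hu
  have h0 : Real.log a₀ ≤ 0 := Real.log_nonpos ha₀.le ha₁
  calc (n.choose k : ℝ) * q ^ (k * (n - k)) ≤ (n : ℝ) ^ k / k.factorial * q ^ (k * (n - k)) := by
        gcongr; exact Nat.choose_le_pow_div k n
    _ = Real.exp (Real.log ((n : ℝ) ^ k / k.factorial * q ^ (k * (n - k)))) :=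
        (Real.exp_log (by positivity)).symm
    _ ≤ _ := by
        rw [Real.exp_le_exp, Real.log_mul (by positivity) (by positivity),
          Real.log_div (by positivity) hf.ne', Real.log_pow, Real.log_pow, Nat.cast_mul,
          Nat.cast_sub (by omega)]
        -- With `L = log n + n log q`, the exponent is `k L - log k! + k (k / n) log n - k (k / n)
        -- L`. Here `log a₀ ≤ L ≤ log A`, and `log a₀ ≤ 0` permits replacing `k / n` by `1 / 2` in
        -- the last term.
        have h1 := log_nat_mul_div_le hk hkn
        have h2 := nat_mul_log_le k
        have h3 : (k : ℝ) * (k / n * Real.log n) ≤ k * (1 + Real.log k / 2) := by gcongr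
        have h4 : (k : ℝ) / n ≤ 1 / 2 := by
          rw [div_le_div_iff₀ hn' two_pos]; linarith
        have h5 : -(k * (k / n * (Real.log n + n * Real.log q))) ≤ -(k * (Real.log a₀ / 2)) := by
          have h6 : k / n * Real.log a₀ ≤ k / n * (Real.log n + n * Real.log q) := by gcongr
          have h7 : Real.log a₀ / 2 ≤ k / n * Real.log a₀ := by nlinarith
          have := mul_le_mul_of_nonneg_left (h7.trans h6) hk'.le
          linarith
        have h8 : (k : ℝ) * (Real.log n + n * Real.log q) ≤ k * Real.log A := by gcongr
        have h9 : (k : ℝ) * (k / n * (Real.log n + n * Real.log q)) =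
            k * (k / n * Real.log n) + k * k * Real.log q := by
          field_simp
        rw [h9] at h5
        linarith

lemma exists_halfCutSum_le {a₀ A : ℝ} (ha₀ : 0 < a₀) (ha₁ : a₀ ≤ 1) :
    ∃ B : ℝ, ∀ (n : ℕ) (q : ℝ), 0 < n → 0 < q → a₀ ≤ n * q ^ n → n * q ^ n ≤ A →
      halfCutSum n q ≤ B := by
  set D := Real.log A + 3 / 2 - Real.log a₀ / 2 with hD
  -- The summand is at most some `t` with `t ^ 2 = x ^ k / k!`. Writing `t = (2 ^ k t) * 2 ^ (-k)`
  -- and applying AM-GM gives a summable majorant without square roots of factorials.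
  set x := Real.exp (2 * D + 4) with hx
  have hsum : Summable fun k : ℕ => (4 * x) ^ k / k.factorial + (1 / 4 : ℝ) ^ k :=
    (Real.summable_pow_div_factorial _).add
      (summable_geometric_of_lt_one (by norm_num) (by norm_num))
  refine ⟨_, fun n q hn hq hl hu => le_trans (Finset.sum_le_sum fun k hk => ?_)
    (hsum.sum_le_tsum (Finset.range (n / 2 + 1)) fun k _ => by positivity)⟩
  have hkn : 2 * k ≤ n := by
    have := Finset.mem_range.1 hk
    omega
  have hf : (0 : ℝ) < k.factorial := by exact_mod_cast k.factorial_pos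
  have h1 := choose_mul_pow_le hkn hn hq ha₀ ha₁ hl hu
  have h2 : ((k : ℝ) + 1) ^ 2 ≤ Real.exp (2 * k) := by
    have := pow_le_pow_left₀ (by positivity) (Real.add_one_le_exp (k : ℝ)) 2
    rwa [← Real.exp_nat_mul, Nat.cast_ofNat] at this
  set t := Real.exp (2 * k + (k * D - Real.log k.factorial / 2)) with ht
  have h3 : ((k : ℝ) + 1) ^ 2 * ((n.choose k : ℝ) * q ^ (k * (n - k))) ≤ t := by
    rw [ht, Real.exp_add]
    gcongr
  have h4 : t ^ 2 = x ^ k / k.factorial := by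
    rw [ht, hx, ← Real.exp_nat_mul, ← Real.exp_nat_mul, ← Real.exp_log hf, ← Real.exp_sub,
      Real.log_exp]
    congr 1
    push_cast
    ring
  have h5 : (4 * x) ^ k / k.factorial = (2 ^ k * t) ^ 2 := by
    rw [mul_pow, mul_pow, h4, ← pow_mul, mul_comm k 2, pow_mul]
    norm_num
    ring
  have h6 : (1 / 4 : ℝ) ^ k = ((1 / 2) ^ k) ^ 2 := by
    rw [← pow_mul, mul_comm k 2, pow_mul]; norm_num
  have h7 : (2 ^ k * t) * (1 / 2) ^ k = t := by
    rw [mul_right_comm, ← mul_pow]; norm_num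
  rw [h5, h6]
  refine h3.trans ?_
  have ht0 : 0 < t := Real.exp_pos _
  nlinarith [sq_nonneg (2 ^ k * t - (1 / 2) ^ k)]

/-! ### Consequences of `n q ^ n → α`. -/

section Limits

variable {q : ℕ → ℝ} {α : ℝ}

lemma eventually_pos_of_tendsto_nat_mul_pow (hα : 0 < α) (hq : ∀ n, 0 ≤ q n)
    (h : Tendsto (fun n : ℕ => (n : ℝ) * q n ^ n) atTop (𝓝 α)) : ∀ᶠ n in atTop, 0 < q n := by
  filter_upwards [h.eventually_const_lt hα, eventually_gt_atTop 0] with n h1 h2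
  refine (hq n).lt_of_ne' fun h0 => ?_
  rw [h0, zero_pow h2.ne', mul_zero] at h1
  exact lt_irrefl _ h1

/-- For large `n`, `log q = log (n q ^ n) / n - log n / n`, and both terms vanish in the limit. -/
lemma tendsto_one_of_tendsto_nat_mul_pow (hα : 0 < α) (hq : ∀ n, 0 ≤ q n)
    (h : Tendsto (fun n : ℕ => (n : ℝ) * q n ^ n) atTop (𝓝 α)) : Tendsto q atTop (𝓝 1) := by
  have h1 : Tendsto (fun n : ℕ => Real.log n / n) atTop (𝓝 0) :=
    (Real.isLittleO_log_id_atTop.tendsto_div_nhds_zero).comp tendsto_natCast_atTop_atTop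
  have h2 : Tendsto (fun n : ℕ => Real.log (n * q n ^ n) / n) atTop (𝓝 0) :=
    (h.log hα.ne').div_atTop tendsto_natCast_atTop_atTop
  have h3 := (Real.continuous_exp.tendsto _).comp (h2.sub h1)
  rw [sub_zero, Real.exp_zero] at h3
  refine h3.congr' ?_
  filter_upwards [eventually_pos_of_tendsto_nat_mul_pow hα hq h, eventually_gt_atTop 0] with n h1 h2
  have hn' : (0 : ℝ) < n := by exact_mod_cast h2
  have : Real.log (n * q n ^ n) / n - Real.log n / n = Real.log (q n) := by
    rw [Real.log_mul hn'.ne' (by positivity), Real.log_pow]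
    field_simp
    ring
  rw [Function.comp_apply, this, Real.exp_log h1]

lemma tendsto_pow_self_of_tendsto_nat_mul_pow
    (h : Tendsto (fun n : ℕ => (n : ℝ) * q n ^ n) atTop (𝓝 α)) :
    Tendsto (fun n => q n ^ n) atTop (𝓝 0) :=
  tendsto_zero_of_tendsto_mul_atTop h

lemma tendsto_choose_mul_pow_mul (h : Tendsto (fun n : ℕ => (n : ℝ) * q n ^ n) atTop (𝓝 α))
    (s : ℕ) :
    Tendsto (fun n => (n.choose s : ℝ) * q n ^ (s * n)) atTop (𝓝 (α ^ s / s.factorial)) := by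
  simp_rw [mul_comm s, pow_mul]
  exact tendsto_choose_mul_pow_atTop s h

lemma tendsto_choose_mul_pow_mul_sub (hα : 0 < α) (hq : ∀ n, 0 ≤ q n)
    (h : Tendsto (fun n : ℕ => (n : ℝ) * q n ^ n) atTop (𝓝 α)) (s : ℕ) :
    Tendsto (fun n => (n.choose s : ℝ) * q n ^ (s * (n - s))) atTop
      (𝓝 (α ^ s / s.factorial)) := by
  have h1 := (tendsto_choose_mul_pow_mul h s).div
    ((tendsto_one_of_tendsto_nat_mul_pow hα hq h).pow (s * s)) (by simp)
  rw [one_pow, div_one] at h1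
  refine h1.congr' ?_
  filter_upwards [eventually_pos_of_tendsto_nat_mul_pow hα hq h, eventually_ge_atTop s] with n h2 h3
  have h4 : s * n = s * (n - s) + s * s := by rw [← mul_add, Nat.sub_add_cancel h3]
  rw [Pi.div_apply, h4, pow_add]
  field_simp

lemma tendsto_pow_sub_one (hα : 0 < α) (hq : ∀ n, 0 ≤ q n)
    (h : Tendsto (fun n : ℕ => (n : ℝ) * q n ^ n) atTop (𝓝 α)) :
    Tendsto (fun n => q n ^ (n - 1)) atTop (𝓝 0) := by
  have h1 := (tendsto_pow_self_of_tendsto_nat_mul_pow h).div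
    (tendsto_one_of_tendsto_nat_mul_pow hα hq h) one_ne_zero
  rw [zero_div] at h1
  refine h1.congr' ?_
  filter_upwards [eventually_pos_of_tendsto_nat_mul_pow hα hq h, eventually_gt_atTop 0] with n h2 h3
  rw [Pi.div_apply, div_eq_iff h2.ne', ← pow_succ, Nat.sub_add_cancel h3]

lemma exists_eventually_halfCutSum_le (hα : 0 < α) (hq : ∀ n, 0 ≤ q n)
    (h : Tendsto (fun n : ℕ => (n : ℝ) * q n ^ n) atTop (𝓝 α)) :
    ∃ B : ℝ, 0 ≤ B ∧ ∀ᶠ n in atTop, halfCutSum n (q n) ≤ B := by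
  have h0 : 0 < min 1 (α / 2) := lt_min one_pos (half_pos hα)
  have h1 : min 1 (α / 2) < α := (min_le_right _ _).trans_lt (half_lt_self hα)
  obtain ⟨B, hB⟩ := exists_halfCutSum_le (A := α + 1) h0 (min_le_left 1 (α / 2))
  refine ⟨max B 0, le_max_right _ _, ?_⟩
  filter_upwards [eventually_pos_of_tendsto_nat_mul_pow hα hq h, eventually_gt_atTop 0,
    h.eventually_const_lt h1, h.eventually_lt_const (lt_add_one α)] with n h2 h3 h4 h5
  exact (hB n (q n) h3 h2 h4.le h5.le).trans (le_max_left _ _)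

end Limits

/-! ### From isolated vertices to components: moments. -/

section FactorialMoments

lemma exists_pow_le_add_mul_two_pow (s : ℕ) {ε : ℝ} (hε : 0 < ε) :
    ∃ K : ℝ, 0 ≤ K ∧ ∀ N : ℕ, (N : ℝ) ^ s ≤ K + ε * 2 ^ N := by
  have h := (isLittleO_pow_const_const_pow_of_one_lt (R := ℝ) s one_lt_two).def hε
  obtain ⟨M, hM⟩ := eventually_atTop.1 h
  refine ⟨(M : ℝ) ^ s, by positivity, fun N => ?_⟩
  rcases le_total M N with hMN | hMN
  · have := hM N hMN
    simp only [norm_pow, Real.norm_natCast, Real.norm_ofNat] at this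
    exact this.trans (le_add_of_nonneg_left (by positivity))
  · exact (pow_le_pow_left₀ (by positivity) (Nat.cast_le.2 hMN) s).trans
      (le_add_of_nonneg_right (by positivity))

/-- Off the exceptional event the two counts agree; on it both binomials are at most `ν ^ s`. The
`K` term will be killed by the small probability, the `ε` term by the bounded exponential moment. -/
lemma abs_choose_sub_choose_le {V : Type*} [Fintype V] (G : SimpleGraph V) (s : ℕ) {K ε : ℝ}
    (hε : 0 ≤ ε) (hK : ∀ N : ℕ, (N : ℝ) ^ s ≤ K + ε * 2 ^ N) :
    |((numComponents G - 1).choose s : ℝ) - (isolatedVerts G).card.choose s| ≤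
      K * Set.indicator {G | HasSmallClosedEdge G ∨ G = ⊥} 1 G + ε * 2 ^ numComponents G := by
  by_cases hG : HasSmallClosedEdge G ∨ G = ⊥
  · rw [Set.indicator_of_mem (by exact hG), Pi.one_apply, mul_one]
    have h : ∀ m ≤ numComponents G, (m.choose s : ℝ) ≤ K + ε * 2 ^ numComponents G := by
      intro m hm
      refine le_trans ?_ (hK _)
      exact_mod_cast (Nat.choose_le_pow m s).trans (Nat.pow_le_pow_left hm s)
    have h1 := h _ (Nat.sub_le (numComponents G) 1)
    have h2 := h _ (card_isolatedVerts_le_numComponents G)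
    exact abs_sub_le_of_nonneg_of_le (Nat.cast_nonneg _) h1 (Nat.cast_nonneg _) h2
  · rw [Set.indicator_of_notMem (by exact hG)]
    rw [not_or] at hG
    rw [numComponents_eq_card_isolatedVerts_add_one hG.2 hG.1, Nat.add_sub_cancel, sub_self,
      abs_zero, mul_zero, zero_add]
    positivity

variable {p : ℕ → unitInterval} {α : ℝ}

lemma tendsto_integral_choose_card_isolatedVerts (hα : 0 < α)
    (hp : Tendsto (fun n : ℕ => (n : ℝ) * (1 - (p n : ℝ)) ^ n) atTop (𝓝 α)) (s : ℕ) :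
    Tendsto (fun n : ℕ => ∫ G, ((isolatedVerts G).card.choose s : ℝ)
      ∂(SimpleGraph.binomialRandom (Fin n) (p n))) atTop (𝓝 (α ^ s / s.factorial)) := by
  have hq : ∀ n, 0 ≤ 1 - (p n : ℝ) := fun n => sub_nonneg.2 (p n).2.2
  refine tendsto_of_tendsto_of_tendsto_of_le_of_le (tendsto_choose_mul_pow_mul hp s)
    (tendsto_choose_mul_pow_mul_sub hα hq hp s) (fun n => ?_) (fun n => ?_)
  · simpa using le_integral_choose_card_isolatedVerts (V := Fin n) (p n) s
  · simpa using integral_choose_card_isolatedVerts_le (V := Fin n) (p n) s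

lemma tendsto_binomialRandom_real_exceptional (hα : 0 < α)
    (hp : Tendsto (fun n : ℕ => (n : ℝ) * (1 - (p n : ℝ)) ^ n) atTop (𝓝 α)) :
    Tendsto (fun n : ℕ => (SimpleGraph.binomialRandom (Fin n) (p n)).real
      {G | HasSmallClosedEdge G ∨ G = ⊥}) atTop (𝓝 0) := by
  have hq : ∀ n, 0 ≤ 1 - (p n : ℝ) := fun n => sub_nonneg.2 (p n).2.2
  obtain ⟨B, hB0, hB⟩ := exists_eventually_halfCutSum_le hα hq hp
  have hp0 : Tendsto (fun n => (p n : ℝ)) atTop (𝓝 0) := by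
    simpa using (tendsto_one_of_tendsto_nat_mul_pow hα hq hp).const_sub 1
  have hlim := (hp0.mul_const B).add (tendsto_pow_sub_one hα hq hp)
  rw [zero_mul, add_zero] at hlim
  refine tendsto_of_tendsto_of_tendsto_of_le_of_le' tendsto_const_nhds hlim
    (Eventually.of_forall fun n => measureReal_nonneg) ?_
  filter_upwards [hB, eventually_gt_atTop 0] with n h1 h2
  have : Nonempty (Fin n) := ⟨⟨0, h2⟩⟩
  refine (measureReal_union_le {G : SimpleGraph (Fin n) | HasSmallClosedEdge G} {G | G = ⊥}).trans
    (add_le_add ?_ ?_)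
  · refine (binomialRandom_real_hasSmallClosedEdge_le (p n)).trans ?_
    rw [Fintype.card_fin]
    exact mul_le_mul_of_nonneg_left h1 (p n).2.1
  · simpa using binomialRandom_real_eq_bot_le (V := Fin n) (p n)

lemma tendsto_integral_choose_numComponents_sub_one (hα : 0 < α)
    (hp : Tendsto (fun n : ℕ => (n : ℝ) * (1 - (p n : ℝ)) ^ n) atTop (𝓝 α)) (s : ℕ) :
    Tendsto (fun n : ℕ => ∫ G, ((numComponents G - 1).choose s : ℝ)
      ∂(SimpleGraph.binomialRandom (Fin n) (p n))) atTop (𝓝 (α ^ s / s.factorial)) := by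
  have hq : ∀ n, 0 ≤ 1 - (p n : ℝ) := fun n => sub_nonneg.2 (p n).2.2
  obtain ⟨B, hB0, hB⟩ := exists_eventually_halfCutSum_le hα hq hp
  refine (tendsto_integral_choose_card_isolatedVerts hα hp s).congr_dist ?_
  rw [Metric.tendsto_nhds]
  intro δ hδ
  -- Chosen so that `ε * 2 B < δ / 2`, also when `B = 0`. Since `K` depends on `ε` but not on `n`,
  -- `n` can be taken large afterwards.
  set ε := δ / (4 * B + 4) with hεdef
  have hε : 0 < ε := by positivity
  obtain ⟨K, hK0, hK⟩ := exists_pow_le_add_mul_two_pow s hε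
  have hlim := (tendsto_binomialRandom_real_exceptional hα hp).const_mul K
  rw [mul_zero] at hlim
  filter_upwards [hB, hlim.eventually_lt_const (half_pos hδ)] with n h1 h2
  rw [Real.dist_0_eq_abs, abs_of_nonneg dist_nonneg, dist_comm, Real.dist_eq,
    ← integral_sub Integrable.of_finite Integrable.of_finite]
  refine (abs_integral_le_integral_abs).trans_lt ?_
  refine (integral_mono Integrable.of_finite Integrable.of_finite
    (fun G => abs_choose_sub_choose_le G s hε.le hK)).trans_lt ?_
  rw [integral_add Integrable.of_finite Integrable.of_finite, integral_const_mul,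
    integral_const_mul, integral_indicator_one MeasurableSet.of_discrete]
  have h3 := integral_two_pow_numComponents_le (V := Fin n) (p n)
  rw [Fintype.card_fin] at h3
  have h4 := mul_le_mul_of_nonneg_left (h3.trans (mul_le_mul_of_nonneg_left h1 zero_le_two)) hε.le
  have h5 : ε * (2 * B) < δ / 2 := by
    rw [hεdef, div_mul_eq_mul_div, div_lt_div_iff₀ (by positivity) two_pos]
    nlinarith
  linarith

lemma factorialPower_natCast (m s : ℕ) :
    factorialPower (m : ℝ) s = s.factorial * (m.choose s : ℝ) := by
  rw [factorialPower, ← descPochhammer_eval_eq_prod_range, descPochhammer_eval_eq_descFactorial,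
    Nat.descFactorial_eq_factorial_mul_choose, Nat.cast_mul]

lemma one_le_numComponents {V : Type*} [Finite V] [Nonempty V] (G : SimpleGraph V) :
    1 ≤ numComponents G :=
  Nat.card_pos

end FactorialMoments

/-! ### Method of moments and convergence in distribution. -/

section Poisson

/-- For `m, J ≥ 1` the alternating sum telescopes to `± C(m - 1, J - 1)`, which Pascal's rule bounds
by `C(m, J)`. -/
lemma abs_ite_sub_alternating_sum_choose_le (m J : ℕ) :
    |(if m = 0 then 1 else 0 : ℝ) - ∑ j ∈ Finset.range J, (-1) ^ j * (m.choose j : ℝ)| ≤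
      m.choose J := by
  cases J with
  | zero => by_cases hm : m = 0 <;> simp [hm]
  | succ J =>
    cases m with
    | zero => simp [Finset.sum_range_succ']
    | succ m =>
      have h := congrArg (Int.cast : ℤ → ℝ)
        (Int.alternating_sum_range_choose_eq_choose (n := m) (m := J))
      push_cast at h
      rw [h, if_neg m.succ_ne_zero, zero_sub, abs_neg, abs_mul, abs_pow, abs_neg, abs_one, one_pow,
        one_mul, Nat.abs_cast, Nat.choose_succ_succ]
      push_cast
      linarith [(m.choose (J + 1)).cast_nonneg (α := ℝ)]

/-- The **Bonferroni inequalities** for the event `x = k`. -/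
lemma abs_ite_eq_sub_alternating_sum_le (x k J : ℕ) :
    |(if x = k then 1 else 0 : ℝ) - ∑ j ∈ Finset.range J,
        (-1) ^ j * ((k + j).choose k : ℝ) * (x.choose (k + j) : ℝ)| ≤
      ((k + J).choose k : ℝ) * x.choose (k + J) := by
  -- Factoring out `C(x, k)` reduces `x = k` to the case `x - k = 0`. Truncated subtraction is
  -- harmless, since `C(x, k) = 0` for `x < k`.
  have hc : ∀ j, ((k + j).choose k : ℝ) * x.choose (k + j) =
      x.choose k * ((x - k).choose j : ℝ) := by
    intro j
    rcases le_or_gt (k + j) x with h | h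
    · have := Nat.choose_mul (n := x) (k := k + j) (s := k) (Nat.le_add_right k j)
      rw [Nat.add_sub_cancel_left] at this
      rw [mul_comm]
      exact_mod_cast this
    · rw [Nat.choose_eq_zero_of_lt h, Nat.cast_zero, mul_zero]
      rcases le_or_gt k x with hk | hk
      · rw [Nat.choose_eq_zero_of_lt (by omega : x - k < j), Nat.cast_zero, mul_zero]
      · rw [Nat.choose_eq_zero_of_lt hk, Nat.cast_zero, zero_mul]
  have hi : (if x = k then 1 else 0 : ℝ) = x.choose k * (if x - k = 0 then 1 else 0 : ℝ) := by
    rcases lt_trichotomy x k with h | h | h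
    · rw [Nat.choose_eq_zero_of_lt h, if_neg h.ne, Nat.cast_zero, zero_mul]
    · subst h; simp
    · rw [if_neg h.ne', if_neg (by omega), mul_zero]
  simp_rw [mul_assoc, hc, mul_left_comm _ (x.choose k : ℝ)]
  rw [← Finset.mul_sum, hi, ← mul_sub, abs_mul, Nat.abs_cast]
  exact mul_le_mul_of_nonneg_left (abs_ite_sub_alternating_sum_choose_le _ _) (Nat.cast_nonneg _)

/-- The method of moments for the Poisson distribution: if the binomial moments of random variables
with values in `ℕ` converge to those of a Poisson distribution, then so do the point
probabilities. -/
lemma tendsto_real_eq_of_tendsto_integral_choose {Ω : ℕ → Type*} [∀ n, MeasurableSpace (Ω n)]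
    [∀ n, Finite (Ω n)] [∀ n, MeasurableSingletonClass (Ω n)] (μ : ∀ n, Measure (Ω n))
    [∀ n, IsFiniteMeasure (μ n)] (X : ∀ n, Ω n → ℕ) (α : ℝ)
    (h : ∀ s : ℕ, Tendsto (fun n => ∫ ω, ((X n ω).choose s : ℝ) ∂μ n) atTop
      (𝓝 (α ^ s / s.factorial))) (k : ℕ) :
    Tendsto (fun n => (μ n).real {ω | X n ω = k}) atTop
      (𝓝 (α ^ k / k.factorial * Real.exp (-α))) := by
  have hcoef : ∀ j : ℕ, ((k + j).choose k : ℝ) * (α ^ (k + j) / (k + j).factorial) =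
      α ^ k / k.factorial * (α ^ j / j.factorial) := by
    intro j
    rw [Nat.choose_symm_add, Nat.add_choose, Nat.cast_div
      (Nat.factorial_mul_factorial_dvd_factorial_add k j)
      (by exact_mod_cast (mul_pos k.factorial_pos j.factorial_pos).ne'), pow_add, Nat.cast_mul]
    have h1 : ((k + j).factorial : ℝ) ≠ 0 := by exact_mod_cast (k + j).factorial_ne_zero
    have h2 : (k.factorial : ℝ) ≠ 0 := by exact_mod_cast k.factorial_ne_zero
    have h3 : (j.factorial : ℝ) ≠ 0 := by exact_mod_cast j.factorial_ne_zero
    field_simp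
  set c := α ^ k / (k.factorial : ℝ) with hc
  have hbound : ∀ J n, |(μ n).real {ω | X n ω = k} - ∑ j ∈ Finset.range J,
      (-1) ^ j * ((k + j).choose k : ℝ) * ∫ ω, ((X n ω).choose (k + j) : ℝ) ∂μ n| ≤
      ((k + J).choose k : ℝ) * ∫ ω, ((X n ω).choose (k + J) : ℝ) ∂μ n := by
    intro J n
    have h1 : (μ n).real {ω | X n ω = k} = ∫ ω, (if X n ω = k then 1 else 0 : ℝ) ∂μ n := by
      rw [← integral_indicator_one MeasurableSet.of_discrete]
      congr 1
      ext ω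
      simp [Set.indicator_apply]
    rw [h1]
    simp_rw [← integral_const_mul]
    rw [← integral_finsetSum _ fun _ _ => Integrable.of_finite,
      ← integral_sub Integrable.of_finite Integrable.of_finite]
    exact abs_integral_le_integral_abs.trans (integral_mono Integrable.of_finite
      Integrable.of_finite fun ω => abs_ite_eq_sub_alternating_sum_le (X n ω) k J)
  have hsum : ∀ J, Tendsto (fun n => ∑ j ∈ Finset.range J,
      (-1) ^ j * ((k + j).choose k : ℝ) * ∫ ω, ((X n ω).choose (k + j) : ℝ) ∂μ n) atTop
      (𝓝 (c * ∑ j ∈ Finset.range J, (-α) ^ j / j.factorial)) := by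
    intro J
    rw [Finset.mul_sum]
    refine tendsto_finsetSum _ fun j _ => ?_
    convert! (h (k + j)).const_mul ((-1) ^ j * ((k + j).choose k : ℝ)) using 2
    rw [mul_assoc, hcoef, neg_pow α]
    ring
  have herr : ∀ J, Tendsto (fun n => ((k + J).choose k : ℝ) *
      ∫ ω, ((X n ω).choose (k + J) : ℝ) ∂μ n) atTop (𝓝 (c * (α ^ J / J.factorial))) := by
    intro J
    rw [← hcoef]
    exact (h (k + J)).const_mul _
  have hexp : Tendsto (fun J => c * ∑ j ∈ Finset.range J, (-α) ^ j / j.factorial) atTop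
      (𝓝 (c * Real.exp (-α))) := by
    have := (NormedSpace.expSeries_div_hasSum_exp (-α)).tendsto_sum_nat
    rw [← Real.exp_eq_exp_ℝ] at this
    exact this.const_mul c
  have hzero : Tendsto (fun J : ℕ => c * (α ^ J / J.factorial)) atTop (𝓝 0) := by
    have := (FloorSemiring.tendsto_pow_div_factorial_atTop α).const_mul c
    rwa [mul_zero] at this
  rw [Metric.tendsto_nhds]
  intro ε hε
  -- The truncation level `J` is fixed first, making the limiting Bonferroni error and the
  -- exponential tail small; only then does `n` grow.
  obtain ⟨J, hJ1, hJ2⟩ := ((hzero.eventually_lt_const (by positivity : 0 < ε / 3)).and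
    (Metric.tendsto_nhds.1 hexp (ε / 3) (by positivity))).exists
  filter_upwards [(herr J).eventually_lt_const hJ1,
    Metric.tendsto_nhds.1 (hsum J) (ε / 3) (by positivity)] with n h1 h2
  have h3 := (hbound J n).trans_lt h1
  rw [← Real.dist_eq] at h3
  refine (dist_triangle4 _ _ _ _).trans_lt (add_lt_add (add_lt_add h3 h2) hJ2) |>.trans_eq ?_
  ring

/-- Random variables whose point probabilities converge to those of a random variable with values
in `ℕ` converge in distribution to that random variable. -/
lemma tendstoInDistribution_natCast {Ω : ℕ → Type*} {m : ∀ n, MeasurableSpace (Ω n)}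
    {μ : ∀ n, Measure (Ω n)} [∀ n, IsProbabilityMeasure (μ n)] {X : ∀ n, Ω n → ℝ}
    (hX : ∀ n, Measurable (X n)) (ν : Measure ℕ) [IsProbabilityMeasure ν]
    (h : ∀ k : ℕ, Tendsto (fun n => (μ n).real {ω | X n ω = k}) atTop (𝓝 (ν.real {k}))) :
    TendstoInDistribution X atTop (fun j : ℕ => (j : ℝ)) μ ν where
  forall_aemeasurable n := (hX n).aemeasurable
  aemeasurable_limit := Measurable.of_discrete.aemeasurable
  tendsto := by
    -- The open-set criterion needs only lower bounds, so finitely many atoms at a time suffice and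
    -- no tightness argument is required.
    refine tendsto_of_forall_isOpen_le_liminf' fun U hU => ?_
    simp only [ProbabilityMeasure.coe_mk]
    rw [Measure.map_apply Measurable.of_discrete hU.measurableSet,
      ← Measure.tsum_indicator_apply_singleton ν _ MeasurableSet.of_discrete,
      ENNReal.tsum_eq_iSup_sum]
    refine iSup_le fun s => ?_
    classical
    simp only [Set.indicator_apply]
    rw [← Finset.sum_filter]
    have hlim : Tendsto (fun n => ∑ k ∈ s.filter (fun k : ℕ => k ∈ (fun j : ℕ => (j : ℝ)) ⁻¹' U),
        μ n {ω | X n ω = k}) atTop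
        (𝓝 (∑ k ∈ s.filter (fun k : ℕ => k ∈ (fun j : ℕ => (j : ℝ)) ⁻¹' U), ν {k})) := by
      refine tendsto_finsetSum _ fun k _ => ?_
      have := ENNReal.tendsto_ofReal (h k)
      simpa only [measureReal_def, ENNReal.ofReal_toReal (measure_ne_top _ _)] using this
    rw [← hlim.liminf_eq]
    refine liminf_le_liminf (Eventually.of_forall fun n => ?_)
    rw [Measure.map_apply (hX n) hU.measurableSet, ← measure_biUnion_finset]
    · refine measure_mono ?_
      intro ω hω
      simp only [Set.mem_iUnion, Finset.mem_filter] at hω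
      obtain ⟨k, ⟨-, hk⟩, hωk⟩ := hω
      rw [Set.mem_preimage, show X n ω = k from hωk]
      exact hk
    · intro i _ j _ hij
      refine Set.disjoint_left.2 fun ω (h1 : X n ω = i) (h2 : X n ω = j) => hij ?_
      exact_mod_cast h1.symm.trans h2
    · exact fun k _ => hX n (measurableSet_singleton _)

end Poisson

/-! ### The main theorem. -/

/-- `SimpleGraph.binomialRandom (Fin n) (p n)` is the law of the random graph `G(n, p n)`. -/
theorem mainTheorem4 (p : ℕ → unitInterval) (α : ℝ) (hα : 0 < α)
    (hp : Tendsto (fun n : ℕ => (n : ℝ) * (1 - (p n : ℝ)) ^ n) atTop (𝓝 α)) :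
    (∀ k : ℕ, 1 ≤ k →
      Tendsto
        (fun n : ℕ => (SimpleGraph.binomialRandom (Fin n) (p n)).real {G | numComponents G = k})
        atTop (𝓝 (α ^ (k - 1) / (Nat.factorial (k - 1) : ℝ) * Real.exp (-α)))) ∧
    TendstoInDistribution
      (fun (n : ℕ) (G : SimpleGraph (Fin n)) => (numComponents G : ℝ) - 1) atTop
      (fun j : ℕ => (j : ℝ))
      (fun n : ℕ => SimpleGraph.binomialRandom (Fin n) (p n)) (poissonMeasure α.toNNReal) ∧
    (∀ s : ℕ,
      Tendsto
        (fun n : ℕ => ∫ G, factorialPower ((numComponents G : ℝ) - 1) s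
          ∂(SimpleGraph.binomialRandom (Fin n) (p n)))
        atTop (𝓝 (α ^ s))) := by
  have hmoment := tendsto_integral_choose_numComponents_sub_one hα hp
  have hpoint : ∀ k : ℕ, Tendsto
      (fun n : ℕ => (SimpleGraph.binomialRandom (Fin n) (p n)).real {G | numComponents G = k + 1})
      atTop (𝓝 (α ^ k / k.factorial * Real.exp (-α))) := by
    intro k
    refine (tendsto_real_eq_of_tendsto_integral_choose
      (fun n => SimpleGraph.binomialRandom (Fin n) (p n)) (fun n G => numComponents G - 1) α hmoment
      k).congr' ?_
    -- For `n = 0` there are no components, and `ν - 1 = k` in `ℕ` would not mean `ν = k + 1` when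
    -- `k = 0`.
    filter_upwards [eventually_gt_atTop 0] with n hn
    have : Nonempty (Fin n) := ⟨⟨0, hn⟩⟩
    congr 1
    ext G
    have := one_le_numComponents G
    simp only [Set.mem_ofPred_eq]
    omega
  refine ⟨fun k hk => ?_, ?_, fun s => ?_⟩
  · have := hpoint (k - 1)
    rwa [Nat.sub_add_cancel hk] at this
  · refine tendstoInDistribution_natCast (fun n => Measurable.of_discrete) _ fun k => ?_
    rw [poissonMeasure_real_singleton, Real.coe_toNNReal _ hα.le, mul_div_assoc, mul_comm]
    convert! hpoint k using 3 with n
    ext G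
    simp only [Set.mem_ofPred_eq, sub_eq_iff_eq_add]
    exact_mod_cast Iff.rfl
  · have h := (hmoment s).const_mul (s.factorial : ℝ)
    rw [mul_div_cancel₀ _ (by exact_mod_cast s.factorial_ne_zero)] at h
    refine h.congr' ?_
    filter_upwards [eventually_gt_atTop 0] with n hn
    have : Nonempty (Fin n) := ⟨⟨0, hn⟩⟩
    rw [← integral_const_mul]
    congr 1
    ext G
    rw [← factorialPower_natCast, Nat.cast_sub (one_le_numComponents G), Nat.cast_one]
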